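/- Let $q$ be a nonzero complex number with $|q|<1$, and write $(x;q)_n=\prod_{i=0}^{n-1}(1-q^i x)$. The three seventh order mock theta functions are $$\mathcal F_0(q)=\sum_{n\ge 0}\frac{q^{n^2}}{(q^{n+1};q)_n},\qquad \mathcal F_1(q)=\sum_{n\ge 1}\frac{q^{n^2}}{(q^{n};q)_n},\qquad \mathcal F_2(q)=\sum_{n\ge 0}\frac{q^{n(n+1)}}{(q^{n+1};q)_{n+1}}.$$ For $a\in\mathbb Z$ put $\Theta_a(q)=\sum_{n\ge 0}(-1)^n q^{an}q^{21\binom{n+1}{2}}$, a series which converges absolutely. Replacing $q$ by $q^{-1}$ in each summand of $\mathcal F_0$, $\mathcal F_1$ (with $n$ replaced by $n+1$) and $\mathcal F_2$ yields, for every $n\ge 0$, respectively $$\frac{(-1)^nq^{\binom{n+1}{2}}}{(q^{n+1};q)_n},\qquad \frac{(-1)^{n+1}q^{\binom{n+1}{2}}}{(q^{n+1};q)_{n+1}},\qquad \frac{(-1)^{n+1}q^{\binom{n+2}{2}}}{(q^{n+1};q)_{n+1}}.$$ The sums of these terms over $n\ge 0$ (the duals of $\mathcal F_0,\mathcal F_1,\mathcal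 F_2$) converge absolutely, and $$\sum_{n\ge 0}\frac{(-1)^nq^{\binom{n+1}{2}}}{(q^{n+1};q)_n}=\Theta_{-10}(q)+q^{10}\Theta_{10}(q)-q\,\Theta_{-4}(q)-q^5\Theta_4(q),$$ $$\sum_{n\ge 0}\frac{(-1)^{n+1}q^{\binom{n+1}{2}}}{(q^{n+1};q)_{n+1}}=-\Theta_{-8}(q)-q^8\Theta_8(q)-q^2\Theta_{-1}(q)-q^3\Theta_1(q),$$ $$\sum_{n\ge 0}\frac{(-1)^{n+1}q^{\binom{n+2}{2}}}{(q^{n+1};q)_{n+1}}=-q\,\Theta_{-5}(q)-q^6\Theta_5(q)-q^2\Theta_{-2}(q)-q^4\Theta_2(q).$$ -/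

import Mathlib

/-- The `q`-Pochhammer symbol `(x; q)_n = ∏_{i=0}^{n-1} (1 - q^i x)`. -/
noncomputable def qPoch (x q : ℂ) (n : ℕ) : ℂ :=
  ∏ i ∈ Finset.range n, (1 - q ^ i * x)

/-- The `n`-th summand (`n ≥ 0`) of the seventh order mock theta function
`F₀(q) = ∑_{n ≥ 0} q^{n²} / (q^{n+1}; q)_n`. -/
noncomputable def seventhF0Term (q : ℂ) (n : ℕ) : ℂ :=
  q ^ (n ^ 2) / qPoch (q ^ (n + 1)) q n

/-- The `n`-th summand (`n ≥ 1`) of the seventh order mock theta function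
`F₁(q) = ∑_{n ≥ 1} q^{n²} / (q^n; q)_n`. -/
noncomputable def seventhF1Term (q : ℂ) (n : ℕ) : ℂ :=
  q ^ (n ^ 2) / qPoch (q ^ n) q n

/-- The `n`-th summand (`n ≥ 0`) of the seventh order mock theta function
`F₂(q) = ∑_{n ≥ 0} q^{n(n+1)} / (q^{n+1}; q)_{n+1}`. -/
noncomputable def seventhF2Term (q : ℂ) (n : ℕ) : ℂ :=
  q ^ (n * (n + 1)) / qPoch (q ^ (n + 1)) q (n + 1)

/-- The `n`-th summand of the partial theta function
`∑_{n ≥ 0} (-1)^n q^{an} q^{21 binom(n+1, 2)}`. -/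
noncomputable def partialThetaTerm (q : ℂ) (a : ℤ) (n : ℕ) : ℂ :=
  (-1) ^ n * q ^ (a * (n : ℤ)) * q ^ (21 * (n + 1).choose 2)

/-- The partial theta function `∑_{n ≥ 0} (-1)^n q^{an} q^{21 binom(n+1, 2)}`. -/
noncomputable def partialTheta (q : ℂ) (a : ℤ) : ℂ :=
  ∑' n : ℕ, partialThetaTerm q a n

/-! This is a Bailey-pair argument. Since `(q;q)_n (q^{n+1};q)_k = (q;q)_{n+k}`, each dual summand
is, up to sign and a factor `q^{n+1}` for F₂, the weight `(-1)^n q^{binom(n+1,2)} (q;q)_n` times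
`1/(q;q)_{2n}` or `1/(q;q)_{2n+1}`.

Two facts are combined. First, summing the weight against `1/((q;q)_{n-r} (q;q)_{n+r+1})` over `n`
gives exactly `(-1)^r q^{binom(r+1,2)}` (`hasSum_dualWeight_mul`). Second, finite Schur-type
identities expand the remaining factor in these same products, with `r` in fixed classes mod 3 and
coefficients `±q^{6k^2+...}` (`sum_dualF0Term`, `sum_schurOddTerm`, `sum_dualF2Term`).

Interchanging the sums (`hasSum_dualWeight_mul_sum`) leaves a single sum over `k`. With `r = 3k +
const` its exponent has leading part `6k^2 + 9k^2/2 = 21k^2/2`, which is the 21 of the partial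
thetas. Each identity has two families of terms, and folding the bilateral index by `k ↦ -k-1`
splits each in two, hence four thetas per dual. -/

/-- `1 / (q; q)_m`, extended by `0` to negative `m`. -/
noncomputable def invQFac (q : ℂ) (m : ℤ) : ℂ :=
  if m < 0 then 0 else (qPoch q q m.toNat)⁻¹

/-- The weight `(-1)^n q^{binom(n+1, 2)} (q; q)_n`. -/
noncomputable def dualWeight (q : ℂ) (n : ℕ) : ℂ :=
  (-1) ^ n * q ^ ((n + 1).choose 2) * qPoch q q n

lemma choose_two_succ (n : ℕ) : (n + 1 + 1).choose 2 = (n + 1).choose 2 + (n + 1) := by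
  have h := Nat.choose_succ_succ' (n + 1) 1
  rw [Nat.choose_one_right] at h
  exact h.trans (add_comm _ _)

lemma one_sub_pow_ne_zero {q : ℂ} (hq1 : ‖q‖ < 1) {m : ℕ} (hm : m ≠ 0) : 1 - q ^ m ≠ 0 := by
  intro h
  have h1 : ‖q ^ m‖ = 1 := by rw [← sub_eq_zero.mp h, norm_one]
  rw [norm_pow] at h1
  exact (pow_lt_one₀ (norm_nonneg q) hq1 hm).ne h1

lemma qPoch_self_succ (q : ℂ) (n : ℕ) :
    qPoch q q (n + 1) = qPoch q q n * (1 - q ^ (n + 1)) := by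
  rw [qPoch, Finset.prod_range_succ, ← qPoch, pow_succ]

lemma qPoch_self_ne_zero {q : ℂ} (hq1 : ‖q‖ < 1) (n : ℕ) : qPoch q q n ≠ 0 := by
  induction n with
  | zero => simp [qPoch]
  | succ n ih =>
    rw [qPoch_self_succ]
    exact mul_ne_zero ih (one_sub_pow_ne_zero hq1 n.succ_ne_zero)

lemma qPoch_self_mul (q : ℂ) (n k : ℕ) :
    qPoch q q n * qPoch (q ^ (n + 1)) q k = qPoch q q (n + k) := by
  rw [qPoch, qPoch, qPoch, Finset.prod_range_add]
  congr 1
  refine Finset.prod_congr rfl fun i _ => ?_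
  ring

lemma invQFac_natCast (q : ℂ) (n : ℕ) : invQFac q n = (qPoch q q n)⁻¹ := by
  simp [invQFac]

lemma invQFac_of_neg (q : ℂ) {m : ℤ} (hm : m < 0) : invQFac q m = 0 := if_pos hm

/-- Extension by zero keeps the recurrence valid for every integer, including `m = 0`, where `1 -
q^0` vanishes. All later identities reduce to it without case splits. -/
lemma invQFac_sub_one {q : ℂ} (hq1 : ‖q‖ < 1) (m : ℤ) :
    invQFac q (m - 1) = (1 - q ^ m) * invQFac q m := by
  rcases lt_trichotomy m 0 with h | rfl | h
  · rw [invQFac_of_neg q h, invQFac_of_neg q (by omega), mul_zero]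
  · simp [invQFac]
  · obtain ⟨n, rfl⟩ : ∃ n : ℕ, m = (n + 1 : ℕ) := ⟨(m - 1).toNat, by omega⟩
    have : ((n + 1 : ℕ) : ℤ) - 1 = (n : ℕ) := by push_cast; ring
    rw [this, invQFac_natCast, invQFac_natCast, qPoch_self_succ, zpow_natCast]
    have := one_sub_pow_ne_zero hq1 n.succ_ne_zero
    have := qPoch_self_ne_zero hq1 n
    field_simp

/-! ### Growth bounds and summability -/

lemma norm_qPoch_self_le {q : ℂ} (hq1 : ‖q‖ < 1) (n : ℕ) : ‖qPoch q q n‖ ≤ 2 ^ n := by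
  induction n with
  | zero => simp [qPoch]
  | succ n ih =>
    rw [qPoch_self_succ, norm_mul, pow_succ (2 : ℝ)]
    have : ‖1 - q ^ (n + 1)‖ ≤ 2 := by
      refine (norm_sub_le _ _).trans ?_
      rw [norm_one, norm_pow]
      linarith [pow_le_one₀ (n := n + 1) (norm_nonneg q) hq1.le]
    gcongr

lemma one_le_inv_one_sub_norm {q : ℂ} (hq1 : ‖q‖ < 1) : 1 ≤ (1 - ‖q‖)⁻¹ :=
  (one_le_inv₀ (by linarith)).2 (by linarith [norm_nonneg q])

lemma norm_inv_qPoch_self_le {q : ℂ} (hq1 : ‖q‖ < 1) (n : ℕ) :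
    ‖(qPoch q q n)⁻¹‖ ≤ (1 - ‖q‖)⁻¹ ^ n := by
  induction n with
  | zero => simp [qPoch]
  | succ n ih =>
    rw [qPoch_self_succ, mul_inv, norm_mul, pow_succ (1 - ‖q‖)⁻¹]
    have : ‖(1 - q ^ (n + 1))⁻¹‖ ≤ (1 - ‖q‖)⁻¹ := by
      rw [norm_inv]
      have h1 : ‖q ^ (n + 1)‖ ≤ ‖q‖ := by
        rw [norm_pow]
        exact pow_le_of_le_one (norm_nonneg q) hq1.le n.succ_ne_zero
      have h2 := norm_sub_norm_le 1 (q ^ (n + 1))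
      rw [norm_one] at h2
      exact inv_anti₀ (by linarith) (by linarith)
    gcongr

lemma norm_invQFac_le {q : ℂ} (hq1 : ‖q‖ < 1) {m : ℤ} {N : ℕ} (hm : m ≤ N) :
    ‖invQFac q m‖ ≤ (1 - ‖q‖)⁻¹ ^ N := by
  have hA := one_le_inv_one_sub_norm hq1
  by_cases h : m < 0
  · rw [invQFac_of_neg q h, norm_zero]; positivity
  · rw [invQFac, if_neg h]
    exact (norm_inv_qPoch_self_le hq1 _).trans (pow_le_pow_right₀ hA (by omega))

lemma norm_dualWeight_mul_le {q : ℂ} (hq1 : ‖q‖ < 1) (n : ℕ) {x y : ℤ} (hx : x ≤ n)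
    (hxy : x + y ≤ 2 * n + 1) :
    ‖dualWeight q n * (invQFac q x * invQFac q y)‖ ≤
      (1 - ‖q‖)⁻¹ * ((2 * (1 - ‖q‖)⁻¹ ^ 3) ^ n * ‖q‖ ^ ((n + 1).choose 2)) := by
  have hA := one_le_inv_one_sub_norm hq1
  -- Either the product vanishes, or `x ≥ 0` and the bound on `x + y` forces `y ≤ 2n + 1`.
  by_cases h : x < 0
  · rw [invQFac_of_neg q h, zero_mul, mul_zero, norm_zero]; positivity
  · have h1 := norm_invQFac_le hq1 hx
    have h2 : ‖invQFac q y‖ ≤ (1 - ‖q‖)⁻¹ ^ (2 * n + 1) :=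
      norm_invQFac_le hq1 (by push_cast; omega)
    have h3 := norm_qPoch_self_le hq1 n
    rw [dualWeight]
    simp only [norm_mul, norm_pow, norm_neg, norm_one, one_pow, one_mul]
    calc _ ≤ ‖q‖ ^ ((n + 1).choose 2) * 2 ^ n *
          ((1 - ‖q‖)⁻¹ ^ n * (1 - ‖q‖)⁻¹ ^ (2 * n + 1)) := by gcongr
      _ = _ := by ring

lemma summable_pow_mul_pow_choose {x : ℝ} (hx0 : 0 < x) (hx1 : x < 1) {B : ℝ} (hB : 0 < B) :
    Summable fun n : ℕ => B ^ n * x ^ ((n + 1).choose 2) := by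
  refine summable_of_ratio_test_tendsto_lt_one (l := 0) one_pos
    (.of_forall fun n => by positivity) ?_
  have h : ∀ n : ℕ, ‖B ^ (n + 1) * x ^ ((n + 1 + 1).choose 2)‖ / ‖B ^ n * x ^ ((n + 1).choose 2)‖
      = B * x ^ (n + 1) := by
    intro n
    rw [Real.norm_of_nonneg (by positivity), Real.norm_of_nonneg (by positivity),
      choose_two_succ]
    field_simp
    ring
  simp_rw [h]
  have := (tendsto_pow_atTop_nhds_zero_of_lt_one hx0.le hx1).comp (Filter.tendsto_add_atTop_nat 1)
  simpa using this.const_mul B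

lemma summable_dualWeight_mul {q : ℂ} (hq0 : q ≠ 0) (hq1 : ‖q‖ < 1) {x y : ℕ → ℤ}
    (hx : ∀ n, x n ≤ n) (hxy : ∀ n, x n + y n ≤ 2 * n + 1) :
    Summable fun n => dualWeight q n * (invQFac q (x n) * invQFac q (y n)) := by
  have hA := one_le_inv_one_sub_norm hq1
  refine .of_norm_bounded
    ((summable_pow_mul_pow_choose (norm_pos_iff.2 hq0) hq1 (by positivity)).mul_left _)
    fun n => norm_dualWeight_mul_le hq1 n (hx n) (hxy n)

/-! ### The weighted sums and the interchange of summation -/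

lemma dualWeight_succ (q : ℂ) (n : ℕ) :
    dualWeight q (n + 1) = -q ^ (n + 1) * (1 - q ^ (n + 1)) * dualWeight q n := by
  rw [dualWeight, dualWeight, choose_two_succ, qPoch_self_succ]; ring

lemma Summable.hasSum_sub_succ {f : ℕ → ℂ} (hf : Summable f) :
    HasSum (fun n => f n - f (n + 1)) (f 0) := by
  have h := (hasSum_nat_add_iff' 1).2 hf.hasSum
  have h2 := hf.hasSum.sub h
  simpa using h2

/-- Telescoping in `n` evaluates the case `r = 0`, and then shows that the sum for `r + 1` is
`-q^{r+1}` times the sum for `r`. -/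
lemma hasSum_dualWeight_mul {q : ℂ} (hq0 : q ≠ 0) (hq1 : ‖q‖ < 1) (r : ℕ) :
    HasSum (fun n : ℕ => dualWeight q n * (invQFac q (n - r) * invQFac q (n + r + 1)))
      ((-1) ^ r * q ^ ((r + 1).choose 2)) := by
  induction r with
  | zero =>
    have h := (summable_dualWeight_mul hq0 hq1 (x := fun n => n) (y := fun n => n)
      (fun n => le_rfl) (fun n => by omega)).hasSum_sub_succ
    convert h using 1
    · funext n
      have h1 := invQFac_sub_one hq1 (n + 1)
      rw [add_sub_cancel_right] at h1
      have h0 := qPoch_self_ne_zero hq1 n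
      have h2 : q ^ ((n : ℤ) + 1) = q ^ (n + 1) := by exact_mod_cast zpow_natCast q (n + 1)
      have h3 := one_sub_pow_ne_zero hq1 n.succ_ne_zero
      rw [h2] at h1
      push_cast
      rw [dualWeight_succ, sub_zero, add_zero, h1]
      ring
    · simp [dualWeight, qPoch, invQFac]
  | succ r ih =>
    -- With this telescoper, summand `r + 1` plus `q^{r+1}` times summand `r` is an exact difference
    -- in `n`; its value at `n = 0` is zero because `-r - 1 < 0`.
    have hs := (summable_dualWeight_mul hq0 hq1 (x := fun n => n - r - 1)
      (y := fun n => n + r + 1) (fun n => by omega) (fun n => by omega)).mul_left (1 + q ^ (r + 1))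
    have h := hs.hasSum_sub_succ.sub (ih.mul_left (q ^ (r + 1)))
    have hv : (-1 : ℂ) ^ (r + 1) * q ^ ((r + 1 + 1).choose 2) =
      (1 + q ^ (r + 1)) * (dualWeight q 0 * (invQFac q ((0 : ℕ) - r - 1) *
        invQFac q ((0 : ℕ) + r + 1))) - q ^ (r + 1) * ((-1) ^ r * q ^ ((r + 1).choose 2)) := by
      rw [choose_two_succ, invQFac_of_neg q (by push_cast; omega)]
      ring
    rw [hv]
    refine (congrArg (fun f : ℕ → ℂ => HasSum f _) (funext fun n => ?_)).mpr h
    have e1 := invQFac_sub_one hq1 (n - r)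
    have e2 := invQFac_sub_one hq1 (n + r + 2)
    have a1 : (n : ℤ) + r + 2 - 1 = n + r + 1 := by ring
    have a2 : (n : ℤ) - (r + 1) = n - r - 1 := by ring
    have a3 : (n : ℤ) + (r + 1) + 1 = n + r + 2 := by ring
    have a4 : (n : ℤ) + 1 - r - 1 = n - r := by ring
    have a5 : (n : ℤ) + 1 + r + 1 = n + r + 2 := by ring
    have p1 : q ^ ((n : ℤ) + r + 2) = q ^ (n + 1) * q ^ (r + 1) := by
      rw [← pow_add, ← zpow_natCast]; congr 1; push_cast; ring
    have p2 : q ^ (n + 1) = q ^ ((n : ℤ) - r) * q ^ (r + 1) := by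
      rw [← zpow_natCast, ← zpow_natCast, ← zpow_add₀ hq0]; congr 1; push_cast; ring
    push_cast
    rw [dualWeight_succ, a2, a3, a4, a5, e1]
    rw [a1] at e2
    rw [e2, p1, p2]
    generalize q ^ (r + 1) = u
    ring

lemma hasSum_dualWeight_mul_sum {q : ℂ} (hq0 : q ≠ 0) (hq1 : ‖q‖ < 1) {c : ℕ → ℂ}
    (hc : ∀ k, ‖c k‖ ≤ 1) {ρ : ℕ → ℕ} (hρ : ∀ k, k ≤ ρ k) :
    HasSum (fun n : ℕ => dualWeight q n * ∑ k ∈ Finset.range (n + 1),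
        c k * (invQFac q (n - ρ k) * invQFac q (n + ρ k + 1)))
      (∑' k, c k * ((-1) ^ ρ k * q ^ ((ρ k + 1).choose 2))) := by
  have hA := one_le_inv_one_sub_norm hq1
  set F : ℕ × ℕ → ℂ := fun x => c x.2 * (dualWeight q x.1 *
    (invQFac q (x.1 - ρ x.2) * invQFac q (x.1 + ρ x.2 + 1))) with hF
  have hzero : ∀ n k : ℕ, n < k → F (n, k) = 0 := by
    intro n k hnk
    have := hρ k
    simp only [hF]
    rw [invQFac_of_neg q (m := (n : ℤ) - ρ k) (by omega)]
    ring
  have hsum : Summable F := by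
    -- The extra factor 2 in `B` pays for `2^n (1/2)^k ≥ 1` on the support `k ≤ n`, which turns a
    -- bound in `n` alone into a product of summable sequences.
    have hb := (summable_pow_mul_pow_choose (norm_pos_iff.2 hq0) hq1
      (B := (2 * (1 - ‖q‖)⁻¹ ^ 3) * 2) (by positivity)).mul_left (1 - ‖q‖)⁻¹
    refine .of_norm_bounded (hb.mul_of_nonneg summable_geometric_two
      (fun n => by positivity) (fun n => by positivity)) ?_
    rintro ⟨n, k⟩
    rcases lt_or_ge n k with hnk | hnk
    · rw [hzero n k hnk, norm_zero]; positivity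
    · simp only [hF]
      rw [norm_mul]
      have h1 := norm_dualWeight_mul_le hq1 n (x := n - ρ k) (y := n + ρ k + 1)
        (by omega) (by omega)
      have h2 : (1 : ℝ) ≤ 2 ^ n * (1 / 2) ^ k := by
        rw [one_div, inv_pow, ← div_eq_mul_inv, one_le_div (by positivity)]
        exact pow_le_pow_right₀ one_le_two hnk
      calc _ ≤ 1 * ((1 - ‖q‖)⁻¹ * ((2 * (1 - ‖q‖)⁻¹ ^ 3) ^ n * ‖q‖ ^ ((n + 1).choose 2))) := by
              gcongr; exact hc k
        _ ≤ (2 ^ n * (1 / 2) ^ k) *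
            ((1 - ‖q‖)⁻¹ * ((2 * (1 - ‖q‖)⁻¹ ^ 3) ^ n * ‖q‖ ^ ((n + 1).choose 2))) := by gcongr
        _ = _ := by rw [mul_pow _ (2 : ℝ)]; ring
  have h1 : HasSum (fun n : ℕ => dualWeight q n * ∑ k ∈ Finset.range (n + 1),
      c k * (invQFac q (n - ρ k) * invQFac q (n + ρ k + 1))) (∑' x, F x) := by
    refine hsum.hasSum.prod_fiberwise fun n => ?_
    have : dualWeight q n * ∑ k ∈ Finset.range (n + 1),
        c k * (invQFac q (n - ρ k) * invQFac q (n + ρ k + 1)) =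
        ∑ k ∈ Finset.range (n + 1), F (n, k) := by
      rw [Finset.mul_sum]
      exact Finset.sum_congr rfl fun k _ => by simp only [hF]; ring
    rw [this]
    exact hasSum_sum_of_ne_finset_zero fun k hk => hzero n k (by simpa using hk)
  have h2 : HasSum (fun k => c k * ((-1) ^ ρ k * q ^ ((ρ k + 1).choose 2))) (∑' x, F x) := by
    have hs : HasSum (F ∘ Prod.swap) (∑' x, F x) :=
      (Equiv.prodComm ℕ ℕ).hasSum_iff.2 hsum.hasSum
    exact hs.prod_fiberwise fun k => (hasSum_dualWeight_mul hq0 hq1 (ρ k)).mul_left (c k)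
  rw [h2.tsum_eq]
  exact h1
-- Finite Schur identities
/-- Bilateral summand of the finite form of Schur's identity at even level `2n`. -/
noncomputable def schurEvenTerm (q : ℂ) (n k : ℤ) : ℂ :=
  q ^ (6 * k ^ 2 + k) * (invQFac q (n - 3 * k) * invQFac q (n + 3 * k)) -
    q ^ (6 * k ^ 2 + 7 * k + 2) * (invQFac q (n - 3 * k - 2) * invQFac q (n + 3 * k + 2))

/-- Bilateral summand of the finite form of Schur's identity at odd level `2n + 1`. -/
noncomputable def schurOddTerm (q : ℂ) (n k : ℤ) : ℂ :=
  q ^ (6 * k ^ 2 + k) * (invQFac q (n - 3 * k) * invQFac q (n + 3 * k + 1)) -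
    q ^ (6 * k ^ 2 + 7 * k + 2) * (invQFac q (n - 3 * k - 1) * invQFac q (n + 3 * k + 2))

/-- The pairs `k`, `-k-1` with `0 ≤ k < M` exhaust the integers from `-M` to `M - 1`. -/
lemma sum_range_fold_telescope (H : ℤ → ℂ) (M : ℕ) :
    ∑ k ∈ Finset.range M, ((H k - H (k + 1)) + (H (-k - 1) - H (-k - 1 + 1))) =
      H (-M) - H M := by
  induction M with
  | zero => simp
  | succ M ih =>
    rw [Finset.sum_range_succ, ih]
    have : -(M : ℤ) - 1 + 1 = -M := by ring
    have h2 : -((M : ℤ) + 1) = -M - 1 := by ring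
    push_cast
    rw [this, h2]
    ring

/-- Over the common factor `1/((q;q)_{n-3k} (q;q)_{n+3k+2})` the odd term collapses to `q^{6k^2+k}
(1 - q^{6k+2})`, and the even term is this times `1 - q^{2n+1}`. The proof writes all powers through
`q^{n-3k-1}` and `q^{6k+2}`. -/
lemma schurOddTerm_mul {q : ℂ} (hq0 : q ≠ 0) (hq1 : ‖q‖ < 1) (n k : ℤ) :
    (1 - q ^ (2 * n + 1)) * schurOddTerm q n k = schurEvenTerm q n k := by
  have e1 := invQFac_sub_one hq1 (n - 3 * k)
  have e2 := invQFac_sub_one hq1 (n - 3 * k - 1)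
  have e3 := invQFac_sub_one hq1 (n + 3 * k + 2)
  have e4 := invQFac_sub_one hq1 (n + 3 * k + 1)
  rw [show n - 3 * k - 1 - 1 = n - 3 * k - 2 by ring, e1] at e2
  rw [show n + 3 * k + 2 - 1 = n + 3 * k + 1 by ring] at e3
  rw [show n + 3 * k + 1 - 1 = n + 3 * k by ring, e3] at e4
  have p1 : q ^ (n - 3 * k) = q * q ^ (n - 3 * k - 1) := by
    rw [← zpow_one_add₀ hq0]; congr 1; ring
  have p2 : q ^ (n + 3 * k + 1) = q ^ (6 * k + 2) * q ^ (n - 3 * k - 1) := by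
    rw [← zpow_add₀ hq0]; congr 1; ring
  have p3 : q ^ (n + 3 * k + 2) = q * (q ^ (6 * k + 2) * q ^ (n - 3 * k - 1)) := by
    rw [← zpow_add₀ hq0, ← zpow_one_add₀ hq0]; congr 1; ring
  have p4 : q ^ (2 * n + 1) =
      q * q ^ (n - 3 * k - 1) * (q ^ (6 * k + 2) * q ^ (n - 3 * k - 1)) := by
    rw [← zpow_add₀ hq0, ← zpow_one_add₀ hq0, ← zpow_add₀ hq0]; congr 1; ring
  have p5 : q ^ (6 * k ^ 2 + 7 * k + 2) = q ^ (6 * k ^ 2 + k) * q ^ (6 * k + 2) := by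
    rw [← zpow_add₀ hq0]; congr 1; ring
  rw [schurOddTerm, schurEvenTerm, e2, e4, e1, e3, p1, p2, p3, p4, p5]
  ring

/-- The certificate telescoping the step from odd to even level. -/
noncomputable def schurCert (q : ℂ) (n k : ℤ) : ℂ :=
  q ^ (6 * k ^ 2 - 2 * k + n + 1) * (invQFac q (n + 1 - 3 * k) * invQFac q (n + 3 * k))

/-- Unlike the step from even to odd level, this one holds only up to a difference in `k`, which
disappears on summation. -/
lemma schurEvenTerm_succ {q : ℂ} (hq0 : q ≠ 0) (hq1 : ‖q‖ < 1) (n k : ℤ) :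
    (1 - q ^ (2 * n + 2)) * schurEvenTerm q (n + 1) k =
      schurOddTerm q n k + (schurCert q n k - schurCert q n (k + 1)) := by
  have e1 := invQFac_sub_one hq1 (n + 1 - 3 * k)
  have e2 := invQFac_sub_one hq1 (n - 3 * k)
  have e3 := invQFac_sub_one hq1 (n - 3 * k - 1)
  have f1 := invQFac_sub_one hq1 (n + 3 * k + 3)
  have f2 := invQFac_sub_one hq1 (n + 3 * k + 2)
  have f3 := invQFac_sub_one hq1 (n + 3 * k + 1)
  rw [show n + 1 - 3 * k - 1 = n - 3 * k by ring] at e1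
  rw [e1] at e2
  rw [show n - 3 * k - 1 - 1 = n - 3 * k - 2 by ring, e2] at e3
  rw [show n + 3 * k + 3 - 1 = n + 3 * k + 2 by ring] at f1
  rw [show n + 3 * k + 2 - 1 = n + 3 * k + 1 by ring, f1] at f2
  rw [show n + 3 * k + 1 - 1 = n + 3 * k by ring, f2] at f3
  have a1 : n + 1 - 3 * k - 2 = n - 3 * k - 1 := by ring
  have a2 : n + 1 + 3 * k = n + 3 * k + 1 := by ring
  have a3 : n + 3 * k + 1 + 2 = n + 3 * k + 3 := by ring
  have a4 : n + 1 - 3 * (k + 1) = n - 3 * k - 2 := by ring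
  have a5 : n + 3 * (k + 1) = n + 3 * k + 3 := by ring
  have p0 : q ^ (n + 1 - 3 * k) = q * (q * q ^ (n - 3 * k - 1)) := by
    rw [← zpow_one_add₀ hq0, ← zpow_one_add₀ hq0]; congr 1; ring
  have p1 : q ^ (n - 3 * k) = q * q ^ (n - 3 * k - 1) := by
    rw [← zpow_one_add₀ hq0]; congr 1; ring
  have p2 : q ^ (n + 3 * k + 1) = q ^ (6 * k + 2) * q ^ (n - 3 * k - 1) := by
    rw [← zpow_add₀ hq0]; congr 1; ring
  have p3 : q ^ (n + 3 * k + 2) = q * (q ^ (6 * k + 2) * q ^ (n - 3 * k - 1)) := by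
    rw [← zpow_add₀ hq0, ← zpow_one_add₀ hq0]; congr 1; ring
  have p6 : q ^ (n + 3 * k + 3) = q * (q * (q ^ (6 * k + 2) * q ^ (n - 3 * k - 1))) := by
    rw [← zpow_add₀ hq0, ← zpow_one_add₀ hq0, ← zpow_one_add₀ hq0]; congr 1; ring
  have p4 : q ^ (2 * n + 2) =
      q * (q * q ^ (n - 3 * k - 1)) * (q ^ (6 * k + 2) * q ^ (n - 3 * k - 1)) := by
    rw [← zpow_add₀ hq0, ← zpow_one_add₀ hq0, ← zpow_one_add₀ hq0, ← zpow_add₀ hq0]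
    congr 1; ring
  have p5 : q ^ (6 * k ^ 2 + 7 * k + 2) = q ^ (6 * k ^ 2 + k) * q ^ (6 * k + 2) := by
    rw [← zpow_add₀ hq0]; congr 1; ring
  have p7 : q ^ (6 * k ^ 2 - 2 * k + n + 1) =
      q ^ (6 * k ^ 2 + k) * (q * (q * q ^ (n - 3 * k - 1))) := by
    rw [← zpow_one_add₀ hq0, ← zpow_one_add₀ hq0, ← zpow_add₀ hq0]; congr 1; ring
  have p8 : q ^ (6 * (k + 1) ^ 2 - 2 * (k + 1) + n + 1) =
      q ^ (6 * k ^ 2 + k) * (q ^ (6 * k + 2) *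
        (q * (q * (q ^ (6 * k + 2) * q ^ (n - 3 * k - 1))))) := by
    rw [← zpow_add₀ hq0 (6 * k + 2) (n - 3 * k - 1), ← zpow_one_add₀ hq0, ← zpow_one_add₀ hq0,
      ← zpow_add₀ hq0, ← zpow_add₀ hq0]; congr 1; ring
  rw [schurOddTerm, schurEvenTerm, schurCert, schurCert, a1, a2, a3, a4, a5, e3, e2, e1, f3, f2,
    f1, p0, p1, p2, p3, p4, p5, p6, p7, p8]
  ring

/-- Both sides obey the same recurrence in `n`. The cutoff `M` is any number above `n`, so that it
stays fixed through the induction. -/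
lemma sum_schurEvenTerm {q : ℂ} (hq0 : q ≠ 0) (hq1 : ‖q‖ < 1) {n M : ℕ} (hM : n < M) :
    ∑ k ∈ Finset.range M, (schurEvenTerm q n k + schurEvenTerm q n (-k - 1)) =
      invQFac q (2 * n) := by
  induction n with
  | zero =>
    rw [Finset.sum_eq_single_of_mem 0 (by simpa using hM)]
    · simp [schurEvenTerm, invQFac, qPoch]
    · intro k _ hk
      rw [schurEvenTerm, schurEvenTerm, invQFac_of_neg q (m := _ - 3 * (k : ℤ)) (by omega),
        invQFac_of_neg q (m := _ - 3 * (k : ℤ) - 2) (by omega),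
        invQFac_of_neg q (m := _ + 3 * (-(k : ℤ) - 1)) (by omega),
        invQFac_of_neg q (m := _ + 3 * (-(k : ℤ) - 1) + 2) (by omega)]
      ring
  | succ n ih =>
    have ih := ih (by omega)
    have hne : 1 - q ^ (2 * (n : ℤ) + 2) ≠ 0 := by
      exact_mod_cast one_sub_pow_ne_zero hq1 (m := 2 * n + 2) (by omega)
    have hne' : 1 - q ^ (2 * (n : ℤ) + 1) ≠ 0 := by
      exact_mod_cast one_sub_pow_ne_zero hq1 (m := 2 * n + 1) (by omega)
    have e1 := invQFac_sub_one hq1 (2 * n + 2)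
    have e2 := invQFac_sub_one hq1 (2 * n + 1)
    rw [show 2 * (n : ℤ) + 2 - 1 = 2 * n + 1 by ring] at e1
    rw [show 2 * (n : ℤ) + 1 - 1 = 2 * n by ring] at e2
    -- Both boundary certificates contain a reciprocal factorial of negative index, so the
    -- telescoped sum is zero.
    have hH := sum_range_fold_telescope (schurCert q n) M
    rw [schurCert, schurCert, invQFac_of_neg q (m := _ + 3 * -(M : ℤ)) (by omega),
      invQFac_of_neg q (m := _ - 3 * (M : ℤ)) (by omega)] at hH
    have hodd : ∑ k ∈ Finset.range M, (schurOddTerm q n k + schurOddTerm q n (-k - 1)) =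
        invQFac q (2 * n + 1) := by
      refine mul_left_cancel₀ hne' ?_
      rw [← e2, ← ih, Finset.mul_sum]
      exact Finset.sum_congr rfl fun k _ => by rw [mul_add, schurOddTerm_mul hq0 hq1,
        schurOddTerm_mul hq0 hq1]
    push_cast
    refine mul_left_cancel₀ hne ?_
    rw [show 2 * ((n : ℤ) + 1) = 2 * n + 2 by ring, ← e1, ← hodd, Finset.mul_sum]
    simp_rw [mul_add, schurEvenTerm_succ hq0 hq1]
    rw [← sub_eq_zero, ← Finset.sum_sub_distrib]
    refine Eq.trans (Finset.sum_congr rfl fun k _ => ?_) (hH.trans (by ring))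
    ring

lemma sum_schurOddTerm {q : ℂ} (hq0 : q ≠ 0) (hq1 : ‖q‖ < 1) {n M : ℕ} (hM : n < M) :
    ∑ k ∈ Finset.range M, (schurOddTerm q n k + schurOddTerm q n (-k - 1)) =
      invQFac q (2 * n + 1) := by
  have hne : 1 - q ^ (2 * (n : ℤ) + 1) ≠ 0 := by
    exact_mod_cast one_sub_pow_ne_zero hq1 (m := 2 * n + 1) (by omega)
  have e2 := invQFac_sub_one hq1 (2 * n + 1)
  rw [show 2 * (n : ℤ) + 1 - 1 = 2 * n by ring] at e2
  refine mul_left_cancel₀ hne ?_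
  rw [← e2, ← sum_schurEvenTerm hq0 hq1 hM, Finset.mul_sum]
  exact Finset.sum_congr rfl fun k _ => by rw [mul_add, schurOddTerm_mul hq0 hq1,
    schurOddTerm_mul hq0 hq1]

/-! ### Companion expansions for F₂ and F₀ -/

/-- Bilateral summand for the dual of `F₂`. -/
noncomputable def dualF2Term (q : ℂ) (n k : ℤ) : ℂ :=
  q ^ (6 * k ^ 2 + 4 * k + 1) * (invQFac q (n - 3 * k) * invQFac q (n + 3 * k + 1) -
    invQFac q (n - 3 * k - 1) * invQFac q (n + 3 * k + 2))

lemma dualF2Term_mul {q : ℂ} (hq0 : q ≠ 0) (hq1 : ‖q‖ < 1) (n k : ℤ) :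
    (1 - q ^ (2 * n + 1)) * dualF2Term q n k = q ^ (n + 1) * schurEvenTerm q n k := by
  have e1 := invQFac_sub_one hq1 (n - 3 * k)
  have e2 := invQFac_sub_one hq1 (n - 3 * k - 1)
  have e3 := invQFac_sub_one hq1 (n + 3 * k + 2)
  have e4 := invQFac_sub_one hq1 (n + 3 * k + 1)
  rw [show n - 3 * k - 1 - 1 = n - 3 * k - 2 by ring, e1] at e2
  rw [show n + 3 * k + 2 - 1 = n + 3 * k + 1 by ring] at e3
  rw [show n + 3 * k + 1 - 1 = n + 3 * k by ring, e3] at e4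
  have p1 : q ^ (n - 3 * k) = q * q ^ (n - 3 * k - 1) := by
    rw [← zpow_one_add₀ hq0]; congr 1; ring
  have p2 : q ^ (n + 3 * k + 1) = q ^ (3 * k + 1) * q ^ (3 * k + 1) * q ^ (n - 3 * k - 1) := by
    rw [← zpow_add₀ hq0, ← zpow_add₀ hq0]; congr 1; ring
  have p3 : q ^ (n + 3 * k + 2) =
      q * (q ^ (3 * k + 1) * q ^ (3 * k + 1) * q ^ (n - 3 * k - 1)) := by
    rw [← zpow_add₀ hq0, ← zpow_add₀ hq0, ← zpow_one_add₀ hq0]; congr 1; ring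
  have p4 : q ^ (2 * n + 1) = q * q ^ (n - 3 * k - 1) *
      (q ^ (3 * k + 1) * q ^ (3 * k + 1) * q ^ (n - 3 * k - 1)) := by
    rw [← zpow_add₀ hq0, ← zpow_add₀ hq0, ← zpow_one_add₀ hq0, ← zpow_add₀ hq0]; congr 1; ring
  have p5 : q ^ (6 * k ^ 2 + 7 * k + 2) =
      q ^ (6 * k ^ 2 + k) * (q ^ (3 * k + 1) * q ^ (3 * k + 1)) := by
    rw [← zpow_add₀ hq0, ← zpow_add₀ hq0]; congr 1; ring
  have p6 : q ^ (6 * k ^ 2 + 4 * k + 1) = q ^ (6 * k ^ 2 + k) * q ^ (3 * k + 1) := by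
    rw [← zpow_add₀ hq0]; congr 1; ring
  have p7 : q ^ (n + 1) = q * (q ^ (3 * k + 1) * q ^ (n - 3 * k - 1)) := by
    rw [← zpow_add₀ hq0, ← zpow_one_add₀ hq0]; congr 1; ring
  rw [dualF2Term, schurEvenTerm, e2, e4, e1, e3, p1, p2, p3, p4, p5, p6, p7]
  ring

lemma sum_dualF2Term {q : ℂ} (hq0 : q ≠ 0) (hq1 : ‖q‖ < 1) {n M : ℕ} (hM : n < M) :
    ∑ k ∈ Finset.range M, (dualF2Term q n k + dualF2Term q n (-k - 1)) =
      q ^ (n + 1) * invQFac q (2 * n + 1) := by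
  have hne : 1 - q ^ (2 * (n : ℤ) + 1) ≠ 0 := by
    exact_mod_cast one_sub_pow_ne_zero hq1 (m := 2 * n + 1) (by omega)
  have e2 := invQFac_sub_one hq1 (2 * n + 1)
  rw [show 2 * (n : ℤ) + 1 - 1 = 2 * n by ring] at e2
  refine mul_left_cancel₀ hne ?_
  rw [mul_left_comm, ← e2, ← sum_schurEvenTerm hq0 hq1 hM, Finset.mul_sum, Finset.mul_sum]
  refine Finset.sum_congr rfl fun k _ => ?_
  rw [mul_add, dualF2Term_mul hq0 hq1, dualF2Term_mul hq0 hq1, mul_add]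
  norm_cast

/-- Bilateral summand for the dual of `F₀`. -/
noncomputable def dualF0Term (q : ℂ) (n k : ℤ) : ℂ :=
  (q ^ (6 * k ^ 2 - k) - q ^ (6 * k ^ 2 + 5 * k + 1)) *
    (invQFac q (n - 3 * k) * invQFac q (n + 3 * k + 1))

/-- The definition has the indices `n - r`, `n + r + 1` that the weighted sums require; this form
has index sum `2n`, for comparison with the even Schur terms. -/
lemma dualF0Term_eq {q : ℂ} (hq0 : q ≠ 0) (hq1 : ‖q‖ < 1) (n k : ℤ) :
    dualF0Term q n k = q ^ (6 * k ^ 2 - k) * (invQFac q (n - 3 * k) * invQFac q (n + 3 * k)) -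
      q ^ (6 * k ^ 2 + 5 * k + 1) * (invQFac q (n - 3 * k - 1) * invQFac q (n + 3 * k + 1)) := by
  have e1 := invQFac_sub_one hq1 (n - 3 * k)
  have e2 := invQFac_sub_one hq1 (n + 3 * k + 1)
  rw [show n + 3 * k + 1 - 1 = n + 3 * k by ring] at e2
  have p1 : q ^ (n + 3 * k + 1) = q ^ (6 * k + 1) * q ^ (n - 3 * k) := by
    rw [← zpow_add₀ hq0]; congr 1; ring
  have p2 : q ^ (6 * k ^ 2 + 5 * k + 1) = q ^ (6 * k ^ 2 - k) * q ^ (6 * k + 1) := by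
    rw [← zpow_add₀ hq0]; congr 1; ring
  rw [dualF0Term, e1, e2, p1, p2]
  ring

lemma sum_dualF0Term {q : ℂ} (hq0 : q ≠ 0) (hq1 : ‖q‖ < 1) {n M : ℕ} (hM : n < M) :
    ∑ k ∈ Finset.range M, (dualF0Term q n k + dualF0Term q n (-k - 1)) =
      invQFac q (2 * n) := by
  rw [← sum_schurEvenTerm hq0 hq1 hM, ← sub_eq_zero, ← Finset.sum_sub_distrib]
  set A : ℤ → ℂ := fun k =>
    q ^ (6 * k ^ 2 + k) * (invQFac q (n - 3 * k) * invQFac q (n + 3 * k)) with hA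
  -- Writing the even Schur term as `A(k) - B(k)`, the F₀ term is `A(-k) - B(-k-1)`. The `B` parts
  -- agree after folding; the `A` parts differ by a telescoping sum, as `k ↦ -k` does not preserve
  -- the window from `-M` to `M - 1`.
  have h := sum_range_fold_telescope (fun k => A (-k)) M
  have hA1 : A M = 0 := by
    simp only [hA]; rw [invQFac_of_neg q (m := _ - 3 * (M : ℤ)) (by omega)]; ring
  have hA2 : A (-M) = 0 := by
    simp only [hA]; rw [invQFac_of_neg q (m := _ + 3 * -(M : ℤ)) (by omega)]; ring
  rw [neg_neg, hA1, hA2, sub_zero] at h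
  refine Eq.trans (Finset.sum_congr rfl fun k _ => ?_) h
  have hterm : ∀ k : ℤ, dualF0Term q n k = A (-k) -
      q ^ (6 * (-k - 1) ^ 2 + 7 * (-k - 1) + 2) *
        (invQFac q (n - 3 * (-k - 1) - 2) * invQFac q (n + 3 * (-k - 1) + 2)) := by
    intro k
    rw [dualF0Term_eq hq0 hq1]
    simp only [hA]
    ring_nf
  have hk : -(-(k : ℤ) - 1) - 1 = k := by ring
  rw [hterm, hterm, hk, schurEvenTerm, schurEvenTerm]
  simp only [hA]
  ring_nf

/-! ### Partial theta functions -/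

lemma summable_partialThetaTerm {q : ℂ} (hq0 : q ≠ 0) (hq1 : ‖q‖ < 1) (a : ℤ) :
    Summable (partialThetaTerm q a) := by
  have hq : 0 < ‖q‖ := norm_pos_iff.2 hq0
  refine .of_norm (((summable_pow_mul_pow_choose (x := ‖q‖ ^ 21) (by positivity)
    (pow_lt_one₀ hq.le hq1 (by norm_num)) (B := ‖q‖ ^ a) (by positivity))).congr fun n => ?_)
  rw [partialThetaTerm]
  simp only [norm_mul, norm_pow, norm_neg, norm_one, one_pow, one_mul, norm_zpow]
  rw [zpow_mul, zpow_natCast, pow_mul]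

lemma hasSum_of_eq {f g : ℕ → ℂ} {s t : ℂ} (h : HasSum f s) (hfg : ∀ n, g n = f n)
    (hst : t = s) : HasSum g t := by
  rw [hst, funext hfg]; exact h

lemma two_mul_choose_two_succ (n : ℕ) : 2 * (((n + 1).choose 2 : ℕ) : ℤ) = n * (n + 1) := by
  induction n with
  | zero => simp
  | succ n ih => rw [choose_two_succ]; push_cast; linarith

/-- One family of expansion terms yields one partial theta. The exponent condition `h` is doubled so
that the binomials become polynomials in `k`. -/
lemma hasSum_dualWeight_partialTheta {q : ℂ} (hq0 : q ≠ 0) (hq1 : ‖q‖ < 1) {E : ℕ → ℤ}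
    (hE : ∀ k, 0 ≤ E k) {ρ : ℕ → ℕ} (hρ : ∀ k, k ≤ ρ k) {ε : ℂ}
    (hε : ∀ k, (-1) ^ ρ k = ε * (-1) ^ k) (s : ℕ) (a : ℤ)
    (h : ∀ k : ℕ, 2 * E k + ρ k * (ρ k + 1) = 2 * s + 2 * a * k + 21 * (k * (k + 1))) :
    HasSum (fun n : ℕ => dualWeight q n * ∑ k ∈ Finset.range (n + 1),
        q ^ E k * (invQFac q (n - ρ k) * invQFac q (n + ρ k + 1)))
      (ε * (q ^ s * partialTheta q a)) := by
  have hc : ∀ k, ‖q ^ E k‖ ≤ 1 := by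
    intro k
    obtain ⟨m, hm⟩ := Int.eq_ofNat_of_zero_le (hE k)
    rw [hm, zpow_natCast, norm_pow]
    exact pow_le_one₀ (norm_nonneg q) hq1.le
  convert hasSum_dualWeight_mul_sum hq0 hq1 hc hρ using 1
  rw [partialTheta, ← tsum_mul_left, ← tsum_mul_left]
  refine tsum_congr fun k => ?_
  have hexp : E k + ((ρ k + 1).choose 2 : ℕ) = s + a * k + (21 * (k + 1).choose 2 : ℕ) := by
    have h1 := two_mul_choose_two_succ (ρ k)
    have h2 := two_mul_choose_two_succ k
    have h3 := h k
    push_cast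
    linarith
  have hpow : q ^ E k * q ^ ((ρ k + 1).choose 2) =
      q ^ s * q ^ (a * (k : ℤ)) * q ^ (21 * (k + 1).choose 2) := by
    rw [← zpow_natCast q ((ρ k + 1).choose 2), ← zpow_natCast q s,
      ← zpow_natCast q (21 * _), ← zpow_add₀ hq0, ← zpow_add₀ hq0, ← zpow_add₀ hq0, hexp]
  rw [partialThetaTerm, hε]
  linear_combination (-ε * (-1) ^ k) * hpow

/-! ### Inversion of the base -/

lemma qPoch_inv {q : ℂ} (hq0 : q ≠ 0) (a n : ℕ) :
    qPoch (q⁻¹ ^ a) q⁻¹ n * q ^ (a * n + n.choose 2) = (-1) ^ n * qPoch (q ^ a) q n := by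
  induction n with
  | zero => simp [qPoch]
  | succ n ih =>
    have hc : (n + 1).choose 2 = n.choose 2 + n := by
      have h := Nat.choose_succ_succ' n 1
      rw [Nat.choose_one_right] at h
      exact h.trans (add_comm _ _)
    have h1 : ∀ x y : ℂ, qPoch x y (n + 1) = qPoch x y n * (1 - y ^ n * x) := fun x y => by
      rw [qPoch, Finset.prod_range_succ, ← qPoch]
    have h2 : (1 - q⁻¹ ^ n * q⁻¹ ^ a) * (q ^ n * q ^ a) = -(1 - q ^ n * q ^ a) := by
      rw [inv_pow, inv_pow]
      field_simp
      ring
    rw [h1, h1, hc]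
    calc _ = (qPoch (q⁻¹ ^ a) q⁻¹ n * q ^ (a * n + n.choose 2)) *
          ((1 - q⁻¹ ^ n * q⁻¹ ^ a) * (q ^ n * q ^ a)) := by ring
      _ = _ := by rw [ih, h2]; ring

lemma qPoch_pow_succ_ne_zero {q : ℂ} (hq1 : ‖q‖ < 1) (n k : ℕ) :
    qPoch (q ^ (n + 1)) q k ≠ 0 := by
  have h := qPoch_self_ne_zero hq1 (n + k)
  rw [← qPoch_self_mul] at h
  exact right_ne_zero_of_mul h

lemma inv_pow_div_qPoch_inv {q : ℂ} (hq0 : q ≠ 0) (hq1 : ‖q‖ < 1) {n k b c : ℕ}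
    (h : b + c = (n + 1) * k + k.choose 2) :
    q⁻¹ ^ b / qPoch (q⁻¹ ^ (n + 1)) q⁻¹ k = (-1) ^ k * q ^ c / qPoch (q ^ (n + 1)) q k := by
  have h1 := qPoch_inv hq0 (n + 1) k
  have h2 := qPoch_pow_succ_ne_zero hq1 n k
  have h3 : qPoch (q⁻¹ ^ (n + 1)) q⁻¹ k ≠ 0 := by
    intro h0
    rw [h0, zero_mul] at h1
    exact mul_ne_zero (pow_ne_zero k (neg_ne_zero.2 one_ne_zero)) h2 h1.symm
  have h4 : ((-1 : ℂ) ^ k) * (-1) ^ k = 1 := by rw [← mul_pow]; simp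
  rw [← h, pow_add q b c] at h1
  rw [div_eq_div_iff h3 h2, inv_pow, inv_mul_eq_iff_eq_mul₀ (pow_ne_zero b hq0)]
  linear_combination (-(-1 : ℂ) ^ k) * h1 - qPoch (q ^ (n + 1)) q k * h4

/-! ### Assembly of the three duals -/

lemma dualWeight_mul_invQFac {q : ℂ} (hq1 : ‖q‖ < 1) (n k : ℕ) :
    dualWeight q n * invQFac q (n + k : ℕ) =
      (-1) ^ n * q ^ ((n + 1).choose 2) / qPoch (q ^ (n + 1)) q k := by
  have h1 := qPoch_self_ne_zero hq1 n
  have h2 := qPoch_pow_succ_ne_zero hq1 n k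
  rw [invQFac_natCast, ← qPoch_self_mul, dualWeight]
  field_simp

lemma hasSum_dual_seventhF0 {q : ℂ} (hq0 : q ≠ 0) (hq1 : ‖q‖ < 1) :
    HasSum (fun n : ℕ => (-1) ^ n * q ^ ((n + 1).choose 2) / qPoch (q ^ (n + 1)) q n)
      (partialTheta q (-10) + q ^ 10 * partialTheta q 10
          - q * partialTheta q (-4) - q ^ 5 * partialTheta q 4) := by
  have s0 : ∀ k : ℕ, ((-1 : ℂ)) ^ (3 * k) = 1 * (-1) ^ k := fun k => by rw [pow_mul]; norm_num
  have s2 : ∀ k : ℕ, ((-1 : ℂ)) ^ (3 * k + 2) = 1 * (-1) ^ k := fun k => by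
    rw [pow_add, s0]; norm_num
  -- `t1` and `t3` come from `k ≥ 0` with `r = 3k`; `t2` and `t4` come from `-k-1`, where the two
  -- indices swap roles and `r = 3k + 2`.
  have t1 := hasSum_dualWeight_partialTheta hq0 hq1 (E := fun k => 6 * k ^ 2 - k)
    (fun k => by nlinarith [Int.natCast_nonneg k, Int.le_self_sq k]) (ρ := fun k => 3 * k)
    (fun k => by omega) s0 0 (-10) (fun k => by push_cast; ring)
  have t2 := hasSum_dualWeight_partialTheta hq0 hq1 (E := fun k => 6 * k ^ 2 + 13 * k + 7)
    (fun k => by positivity) (ρ := fun k => 3 * k + 2)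
    (fun k => by omega) s2 10 10 (fun k => by push_cast; ring)
  have t3 := hasSum_dualWeight_partialTheta hq0 hq1 (E := fun k => 6 * k ^ 2 + 5 * k + 1)
    (fun k => by positivity) (ρ := fun k => 3 * k)
    (fun k => by omega) s0 1 (-4) (fun k => by push_cast; ring)
  have t4 := hasSum_dualWeight_partialTheta hq0 hq1 (E := fun k => 6 * k ^ 2 + 7 * k + 2)
    (fun k => by positivity) (ρ := fun k => 3 * k + 2)
    (fun k => by omega) s2 5 4 (fun k => by push_cast; ring)
  refine hasSum_of_eq (((t1.add t2).sub t3).sub t4) (fun n => ?_) (by ring)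
  have h := dualWeight_mul_invQFac hq1 n n
  have hn : ((n + n : ℕ) : ℤ) = 2 * n := by push_cast; ring
  rw [hn] at h
  rw [← h, ← sum_dualF0Term hq0 hq1 n.lt_succ_self, ← mul_add, ← mul_sub, ← mul_sub,
    ← Finset.sum_add_distrib, ← Finset.sum_sub_distrib, ← Finset.sum_sub_distrib]
  congr 1
  refine Finset.sum_congr rfl fun k _ => ?_
  rw [dualF0Term, dualF0Term]
  push_cast
  ring_nf

lemma hasSum_dual_seventhF1 {q : ℂ} (hq0 : q ≠ 0) (hq1 : ‖q‖ < 1) :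
    HasSum (fun n : ℕ =>
        (-1) ^ (n + 1) * q ^ ((n + 1).choose 2) / qPoch (q ^ (n + 1)) q (n + 1))
      (-partialTheta q (-8) - q ^ 8 * partialTheta q 8
          - q ^ 2 * partialTheta q (-1) - q ^ 3 * partialTheta q 1) := by
  have s0 : ∀ k : ℕ, ((-1 : ℂ)) ^ (3 * k) = 1 * (-1) ^ k := fun k => by rw [pow_mul]; norm_num
  have s1 : ∀ k : ℕ, ((-1 : ℂ)) ^ (3 * k + 1) = (-1) * (-1) ^ k := fun k => by
    rw [pow_succ, s0]; ring
  have s2 : ∀ k : ℕ, ((-1 : ℂ)) ^ (3 * k + 2) = 1 * (-1) ^ k := fun k => by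
    rw [pow_add, s0]; norm_num
  have t1 := hasSum_dualWeight_partialTheta hq0 hq1 (E := fun k => 6 * k ^ 2 + k)
    (fun k => by positivity) (ρ := fun k => 3 * k)
    (fun k => by omega) s0 0 (-8) (fun k => by push_cast; ring)
  have t2 := hasSum_dualWeight_partialTheta hq0 hq1 (E := fun k => 6 * k ^ 2 + 11 * k + 5)
    (fun k => by positivity) (ρ := fun k => 3 * k + 2)
    (fun k => by omega) s2 8 8 (fun k => by push_cast; ring)
  -- The subtracted Schur family has `r = 3k + 1` on both halves: `t3` is the half `-k-1`, `t4` the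
  -- half `k`.
  have t3 := hasSum_dualWeight_partialTheta hq0 hq1 (E := fun k => 6 * k ^ 2 + 5 * k + 1)
    (fun k => by positivity) (ρ := fun k => 3 * k + 1)
    (fun k => by omega) s1 2 (-1) (fun k => by push_cast; ring)
  have t4 := hasSum_dualWeight_partialTheta hq0 hq1 (E := fun k => 6 * k ^ 2 + 7 * k + 2)
    (fun k => by positivity) (ρ := fun k => 3 * k + 1)
    (fun k => by omega) s1 3 1 (fun k => by push_cast; ring)
  refine hasSum_of_eq ((((t1.add t2).sub t3).sub t4).neg) (fun n => ?_) (by ring)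
  have h := dualWeight_mul_invQFac hq1 n (n + 1)
  have hn : ((n + (n + 1) : ℕ) : ℤ) = 2 * n + 1 := by push_cast; ring
  rw [hn] at h
  rw [pow_succ, mul_neg_one, neg_mul, neg_div, ← h, ← sum_schurOddTerm hq0 hq1 n.lt_succ_self,
    ← mul_add, ← mul_sub, ← mul_sub,
    ← Finset.sum_add_distrib, ← Finset.sum_sub_distrib, ← Finset.sum_sub_distrib]
  congr 2
  refine Finset.sum_congr rfl fun k _ => ?_
  rw [schurOddTerm, schurOddTerm]
  push_cast
  ring_nf

lemma hasSum_dual_seventhF2 {q : ℂ} (hq0 : q ≠ 0) (hq1 : ‖q‖ < 1) :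
    HasSum (fun n : ℕ =>
        (-1) ^ (n + 1) * q ^ ((n + 2).choose 2) / qPoch (q ^ (n + 1)) q (n + 1))
      (-(q * partialTheta q (-5)) - q ^ 6 * partialTheta q 5
          - q ^ 2 * partialTheta q (-2) - q ^ 4 * partialTheta q 2) := by
  have s0 : ∀ k : ℕ, ((-1 : ℂ)) ^ (3 * k) = 1 * (-1) ^ k := fun k => by rw [pow_mul]; norm_num
  have s1 : ∀ k : ℕ, ((-1 : ℂ)) ^ (3 * k + 1) = (-1) * (-1) ^ k := fun k => by
    rw [pow_succ, s0]; ring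
  have s2 : ∀ k : ℕ, ((-1 : ℂ)) ^ (3 * k + 2) = 1 * (-1) ^ k := fun k => by
    rw [pow_add, s0]; norm_num
  have t1 := hasSum_dualWeight_partialTheta hq0 hq1 (E := fun k => 6 * k ^ 2 + 4 * k + 1)
    (fun k => by positivity) (ρ := fun k => 3 * k)
    (fun k => by omega) s0 1 (-5) (fun k => by push_cast; ring)
  have t2 := hasSum_dualWeight_partialTheta hq0 hq1 (E := fun k => 6 * k ^ 2 + 8 * k + 3)
    (fun k => by positivity) (ρ := fun k => 3 * k + 2)
    (fun k => by omega) s2 6 5 (fun k => by push_cast; ring)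
  have t3 := hasSum_dualWeight_partialTheta hq0 hq1 (E := fun k => 6 * k ^ 2 + 4 * k + 1)
    (fun k => by positivity) (ρ := fun k => 3 * k + 1)
    (fun k => by omega) s1 2 (-2) (fun k => by push_cast; ring)
  have t4 := hasSum_dualWeight_partialTheta hq0 hq1 (E := fun k => 6 * k ^ 2 + 8 * k + 3)
    (fun k => by positivity) (ρ := fun k => 3 * k + 1)
    (fun k => by omega) s1 4 2 (fun k => by push_cast; ring)
  refine hasSum_of_eq ((((t1.add t2).sub t3).sub t4).neg) (fun n => ?_) (by ring)
  have h := dualWeight_mul_invQFac hq1 n (n + 1)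
  have hn : ((n + (n + 1) : ℕ) : ℤ) = 2 * n + 1 := by push_cast; ring
  rw [hn] at h
  have h' : (-1) ^ (n + 1) * q ^ ((n + 2).choose 2) / qPoch (q ^ (n + 1)) q (n + 1) =
      -(dualWeight q n * (q ^ (n + 1) * invQFac q (2 * n + 1))) := by
    rw [mul_left_comm, h, choose_two_succ]; ring
  rw [h', ← sum_dualF2Term hq0 hq1 n.lt_succ_self, ← mul_add, ← mul_sub, ← mul_sub,
    ← Finset.sum_add_distrib, ← Finset.sum_sub_distrib, ← Finset.sum_sub_distrib]
  congr 2
  refine Finset.sum_congr rfl fun k _ => ?_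
  rw [dualF2Term, dualF2Term]
  push_cast
  ring_nf

theorem mainTheorem3 (q : ℂ) (hq0 : q ≠ 0) (hq1 : ‖q‖ < 1) :
    (∀ a : ℤ, Summable (partialThetaTerm q a)) ∧
    -- the dual of F₀
    ((∀ n : ℕ, seventhF0Term q⁻¹ n =
        (-1) ^ n * q ^ ((n + 1).choose 2) / qPoch (q ^ (n + 1)) q n) ∧
      HasSum (fun n : ℕ =>
          (-1) ^ n * q ^ ((n + 1).choose 2) / qPoch (q ^ (n + 1)) q n)
        (partialTheta q (-10) + q ^ 10 * partialTheta q 10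
          - q * partialTheta q (-4) - q ^ 5 * partialTheta q 4)) ∧
    -- the dual of F₁, whose defining sum starts at 1 and is reindexed by n + 1
    ((∀ n : ℕ, seventhF1Term q⁻¹ (n + 1) =
        (-1) ^ (n + 1) * q ^ ((n + 1).choose 2) / qPoch (q ^ (n + 1)) q (n + 1)) ∧
      HasSum (fun n : ℕ =>
          (-1) ^ (n + 1) * q ^ ((n + 1).choose 2) / qPoch (q ^ (n + 1)) q (n + 1))
        (-partialTheta q (-8) - q ^ 8 * partialTheta q 8
          - q ^ 2 * partialTheta q (-1) - q ^ 3 * partialTheta q 1)) ∧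
    -- the dual of F₂
    ((∀ n : ℕ, seventhF2Term q⁻¹ n =
        (-1) ^ (n + 1) * q ^ ((n + 2).choose 2) / qPoch (q ^ (n + 1)) q (n + 1)) ∧
      HasSum (fun n : ℕ =>
          (-1) ^ (n + 1) * q ^ ((n + 2).choose 2) / qPoch (q ^ (n + 1)) q (n + 1))
        (-(q * partialTheta q (-5)) - q ^ 6 * partialTheta q 5
          - q ^ 2 * partialTheta q (-2) - q ^ 4 * partialTheta q 2)) := by
  have hc : ∀ n : ℕ, 2 * (n.choose 2 : ℤ) + n = n * n := by
    intro n
    cases n with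
    | zero => simp
    | succ n => rw [two_mul_choose_two_succ]; push_cast; ring
  refine ⟨summable_partialThetaTerm hq0 hq1, ⟨fun n => ?_, hasSum_dual_seventhF0 hq0 hq1⟩,
    ⟨fun n => ?_, hasSum_dual_seventhF1 hq0 hq1⟩, fun n => ?_, hasSum_dual_seventhF2 hq0 hq1⟩
  · refine inv_pow_div_qPoch_inv hq0 hq1 ?_
    have h1 := hc n
    have h2 := hc (n + 1)
    zify
    push_cast at *
    linarith
  · refine inv_pow_div_qPoch_inv hq0 hq1 ?_
    have h2 := hc (n + 1)
    zify
    push_cast at *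
    linarith
  · refine inv_pow_div_qPoch_inv hq0 hq1 ?_
    have h1 := hc (n + 1)
    have h2 := hc (n + 2)
    zify
    push_cast at *
    linarith
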